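/- Let $g,d\in\mathbb N$, let $\mathbf k=(k_1,\dots,k_g)$ with all $k_x\ge 1$, and let $\bar\sigma$ be an invertible $d\times d$ density matrix (complex, positive semidefinite, trace one). All families below are indexed by $x\in[g]$, $a\in[k_x]$ and consist of complex $d\times d$ matrices. Let $\mathcal Q_{\bar\sigma}(g,\mathbf k,d)$ be the set of assemblages with average $\bar\sigma$, i.e. families $(\sigma_{a|x})$ of positive semidefinite matrices with $\sum_a\sigma_{a|x}=\bar\sigma$ for all $x$. A family $(\sigma_{a|x})$ has an LHS model if there are a finite set $\Lambda$, a probability distribution $(q_\lambda)_{\lambda\in\Lambda}$, conditional probabilities $p(a|x,\lambda)$ (i.e. $p\ge0$, $\sum_a p(a|x,\lambda)=1$) and density matrices $\sigma_\lambda$ with $\sigma_{a|x}=\sum_\lambda q_\lambda p(a|x,\lambda)\sigma_\lambda$ for all $a,x$. Let $\mathcal L_{\bar\sigma}(g,\mathbf k,d)$ be the set of families of positive semidefinite matrices having such a model with $\sum_\lambda q_\lambda\sigma_\lambda=\bar\sigma$. A POVM is a finite family of positive semidefinite matrices with sum $I_d$; a $g$-tuple of POVMs $(E_{a|x})_{a\in[k_x]}$,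 $x\in[g]$, is compatible if there are a finite set $\Lambda$, a POVM $(E_\lambda)_{\lambda\in\Lambda}$ and conditional probabilities $p(a|x,\lambda)$ with $E_{a|x}=\sum_\lambda p(a|x,\lambda)E_\lambda$. Write $\boldsymbol{\bar\sigma}=(\bar\sigma/k_x)_{a,x}$ for the trivial assemblage, and, for $\mathbf s\in[0,1]^g$, $\mathbf s.\boldsymbol\sigma+(\mathbf 1-\mathbf s).\boldsymbol{\bar\sigma}=(s_x\sigma_{a|x}+(1-s_x)\bar\sigma/k_x)_{a,x}$. For a tuple $\mathbf A=(A_i)_{i\in I}$ of self-adjoint matrices and $n\in\mathbb N$ let $\mathcal D_{\mathbf A}(n)$ be the set of tuples $(X_i)_{i\in I}$ of self-adjoint $n\times n$ matrices with $\sum_i A_i\otimes X_i\le I$. The matrix jewel $\mathcal D_{\blacklozenge,\mathbf k}$ is the free spectrahedron $\mathcal D_{\mathbf A}$ for the tuple indexed by the pairs $(x,j)$, $x\in[g]$, $j\in[k_x-1]$, of diagonal matrices $A_{(x,j)}$ with rows and columns indexed by $\varepsilon\in[k_1]\times\dots\times[k_g]$ and diagonal entries $-\frac{2}{k_x}+2\delta_{\varepsilon_x,j}$.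 Its inclusion constant set $\Delta_{\blacklozenge}(g,\mathbf k,d)$ is the set of all $\mathbf s\in[0,1]^g$ such that, for every tuple $\mathbf B=(B_{(x,j)})$ of self-adjoint $d\times d$ matrices, $\mathcal D_{\blacklozenge,\mathbf k}(1)\subseteq\mathcal D_{\mathbf B}(1)$ implies that $(s_xX_{(x,j)})_{(x,j)}\in\mathcal D_{\mathbf B}(n)$ for all $n$ and all $(X_{(x,j)})\in\mathcal D_{\blacklozenge,\mathbf k}(n)$. Then: (0) The maps $\sigma_{a|x}\mapsto E_{a|x}=\bar\sigma^{-1/2}\sigma_{a|x}\bar\sigma^{-1/2}$ and $E_{a|x}\mapsto\bar\sigma^{1/2}E_{a|x}\bar\sigma^{1/2}$ are mutually inverse bijections between $\mathcal Q_{\bar\sigma}(g,\mathbf k,d)$ and the set of $g$-tuples of POVMs with $k_1,\dots,k_g$ outcomes in dimension $d$. (1) An assemblage in $\mathcal Q_{\bar\sigma}(g,\mathbf k,d)$ has an LHS model if and only if the corresponding $g$-tuple of POVMs is compatible. (2) Under these two maps, mixing with the trivial assemblage corresponds to mixing in white noise: for all $\mathbf s\in[0,1]^g$, $s_x\sigma_{a|x}+(1-s_x)\frac{\bar\sigma}{k_x}\longleftrightarrow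 s_xE_{a|x}+(1-s_x)\frac{I_d}{k_x}$. (3) $$\{\mathbf s\in[0,1]^g:\ \mathbf s.\mathcal Q_{\bar\sigma}(g,\mathbf k,d)+(\mathbf 1-\mathbf s).\boldsymbol{\bar\sigma}\subseteq\mathcal L_{\bar\sigma}(g,\mathbf k,d)\}=\Delta_{\blacklozenge}(g,\mathbf k,d).$$ -/

import Mathlib

open scoped Kronecker ComplexOrder MatrixOrder

noncomputable section

namespace Steering

/-- A density matrix: positive semidefinite with unit trace. -/
structure IsDensityMatrix {d : ℕ} (ρ : Matrix (Fin d) (Fin d) ℂ) : Prop where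
  posSemidef : ρ.PosSemidef
  trace_eq_one : ρ.trace = 1

/-- Families of `d × d` complex matrices `(M_{a|x})`, with `x ∈ [g]` and `a ∈ [k_x]`;
`M_{a|x}` is written `M x a`. -/
abbrev Family (g : ℕ) (k : Fin g → ℕ) (d : ℕ) : Type :=
  (x : Fin g) → Fin (k x) → Matrix (Fin d) (Fin d) ℂ

/-- A POVM with outcomes in a finite set `Λ`. -/
structure IsPOVM {d : ℕ} {Λ : Type} [Fintype Λ] (E : Λ → Matrix (Fin d) (Fin d) ℂ) : Prop where
  posSemidef : ∀ l, (E l).PosSemidef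
  sum_eq_one : ∑ l, E l = 1

/-- Conditional probabilities `p(a|x,l)`, written `p x a l`. -/
structure IsCondProb {g : ℕ} {k : Fin g → ℕ} {Λ : Type}
    (p : (x : Fin g) → Fin (k x) → Λ → ℝ) : Prop where
  nonneg : ∀ x a l, 0 ≤ p x a l
  sum_eq_one : ∀ x l, ∑ a, p x a l = 1

/-- The `g`-tuples of POVMs having `k_1, …, k_g` outcomes in dimension `d`. -/
def povmTuples (g : ℕ) (k : Fin g → ℕ) (d : ℕ) : Set (Family g k d) :=
  {E | ∀ x, IsPOVM (E x)}

/-- Compatibility (joint measurability): all `E_{a|x}` arise from one POVM by classical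
probabilistic post-processing. -/
def Compatible {g : ℕ} {k : Fin g → ℕ} {d : ℕ} (E : Family g k d) : Prop :=
  ∃ (Λ : Type) (_ : Fintype Λ) (G : Λ → Matrix (Fin d) (Fin d) ℂ)
    (p : (x : Fin g) → Fin (k x) → Λ → ℝ),
    IsPOVM G ∧ IsCondProb p ∧ ∀ x a, E x a = ∑ l, p x a l • G l

/-- `(q, p, τ)` is a local hidden state model, with hidden variable in the finite set `Λ`,
for the family `σ`. -/
structure IsLHSModel {g : ℕ} {k : Fin g → ℕ} {d : ℕ} (σ : Family g k d) {Λ : Type} [Fintype Λ]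
    (q : Λ → ℝ) (p : (x : Fin g) → Fin (k x) → Λ → ℝ)
    (τ : Λ → Matrix (Fin d) (Fin d) ℂ) : Prop where
  weight_nonneg : ∀ l, 0 ≤ q l
  weight_sum : ∑ l, q l = 1
  condProb : IsCondProb p
  state : ∀ l, IsDensityMatrix (τ l)
  eq_sum : ∀ x a, σ x a = ∑ l, (q l * p x a l) • τ l

/-- The family `σ` has a local hidden state model. -/
def HasLHSModel {g : ℕ} {k : Fin g → ℕ} {d : ℕ} (σ : Family g k d) : Prop :=
  ∃ (Λ : Type) (_ : Fintype Λ) (q : Λ → ℝ) (p : (x : Fin g) → Fin (k x) → Λ → ℝ)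
    (τ : Λ → Matrix (Fin d) (Fin d) ℂ), IsLHSModel σ q p τ

/-- The set `𝒬_σ̄(g, k, d)` of all assemblages with average `avg`. -/
def assemblages {g : ℕ} (k : Fin g → ℕ) {d : ℕ} (avg : Matrix (Fin d) (Fin d) ℂ) :
    Set (Family g k d) :=
  {σ | (∀ x a, (σ x a).PosSemidef) ∧ ∀ x, ∑ a, σ x a = avg}

/-- The set `ℒ_σ̄(g, k, d)` of assemblages having a local hidden state model whose ensemble
has average `avg`. -/
def lhsAssemblages {g : ℕ} (k : Fin g → ℕ) {d : ℕ} (avg : Matrix (Fin d) (Fin d) ℂ) :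
    Set (Family g k d) :=
  {σ | (∀ x a, (σ x a).PosSemidef) ∧
    ∃ (Λ : Type) (_ : Fintype Λ) (q : Λ → ℝ) (p : (x : Fin g) → Fin (k x) → Λ → ℝ)
      (τ : Λ → Matrix (Fin d) (Fin d) ℂ), IsLHSModel σ q p τ ∧ ∑ l, q l • τ l = avg}

/-- `σ_{a|x} ↦ σ̄^{-1/2} σ_{a|x} σ̄^{-1/2}`. -/
def toPOVM {g : ℕ} {k : Fin g → ℕ} {d : ℕ} (avg : Matrix (Fin d) (Fin d) ℂ)
    (σ : Family g k d) : Family g k d :=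
  fun x a => (CFC.sqrt avg)⁻¹ * σ x a * (CFC.sqrt avg)⁻¹

/-- `E_{a|x} ↦ σ̄^{1/2} E_{a|x} σ̄^{1/2}`. -/
def ofPOVM {g : ℕ} {k : Fin g → ℕ} {d : ℕ} (avg : Matrix (Fin d) (Fin d) ℂ)
    (E : Family g k d) : Family g k d :=
  fun x a => CFC.sqrt avg * E x a * CFC.sqrt avg

/-- The trivial assemblage `(σ̄ / k_x)_{a|x}`. -/
def trivialAssemblage {g : ℕ} (k : Fin g → ℕ) {d : ℕ} (avg : Matrix (Fin d) (Fin d) ℂ) :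
    Family g k d :=
  fun x _ => (k x : ℝ)⁻¹ • avg

/-- The white noise POVMs `(I_d / k_x)_{a|x}`. -/
def whiteNoise {g : ℕ} (k : Fin g → ℕ) (d : ℕ) : Family g k d :=
  fun x _ => (k x : ℝ)⁻¹ • (1 : Matrix (Fin d) (Fin d) ℂ)

/-- The mixture `s.M + (1 - s).N`, with entries `s_x M_{a|x} + (1 - s_x) N_{a|x}`. -/
def mix {g : ℕ} {k : Fin g → ℕ} {d : ℕ} (s : Fin g → ℝ) (M N : Family g k d) : Family g k d :=
  fun x a => s x • M x a + (1 - s x) • N x a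

/-- The level `n` of the monic free spectrahedron `𝒟_A`: tuples `X` of self-adjoint
`n × n` matrices with `∑ i, A i ⊗ X i ≤ I`. -/
def freeSpectrahedron {ι m : Type} [Fintype ι] [Fintype m] [DecidableEq m]
    (A : ι → Matrix m m ℂ) (n : ℕ) : Set (ι → Matrix (Fin n) (Fin n) ℂ) :=
  {X | (∀ i, (X i).IsHermitian) ∧
    ((1 : Matrix (m × Fin n) (m × Fin n) ℂ) - ∑ i, A i ⊗ₖ X i).PosSemidef}

/-- The index set of the matrix jewel: pairs of `x ∈ [g]` and `j ∈ [k_x - 1]`. -/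
abbrev JewelIndex {g : ℕ} (k : Fin g → ℕ) : Type := (x : Fin g) × Fin (k x - 1)

/-- The vectors `v_1, …, v_{r-1} ∈ ℝ^r` of the matrix jewel base: all entries of `v_j` are
`-2/r`, except for the `j`-th one, which is `2 - 2/r`. -/
def jewelVec (r : ℕ) (j : Fin (r - 1)) (e : Fin r) : ℝ :=
  -(2 / (r : ℝ)) + if (e : ℕ) = (j : ℕ) then 2 else 0

/-- The diagonal matrices of size `k_1 ⋯ k_g` defining the matrix jewel; up to the identification
of `⨂ x, ℂ^{k_x}` with functions on `∏ x, [k_x]`, the matrix with index `(x, j)` is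
`I ⊗ ⋯ ⊗ I ⊗ diag(v_j) ⊗ I ⊗ ⋯ ⊗ I`, with `diag(v_j)` in position `x`. Thus the matrix jewel is the
(maximal) direct sum of its `g` bases. -/
def jewelMatrix {g : ℕ} (k : Fin g → ℕ) (i : JewelIndex k) :
    Matrix ((x : Fin g) → Fin (k x)) ((x : Fin g) → Fin (k x)) ℂ :=
  Matrix.diagonal fun e => ((jewelVec (k i.1) i.2 (e i.1) : ℝ) : ℂ)

/-- The level `n` of the matrix jewel. -/
def matrixJewel {g : ℕ} (k : Fin g → ℕ) (n : ℕ) : Set (JewelIndex k → Matrix (Fin n) (Fin n) ℂ) :=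
  freeSpectrahedron (jewelMatrix k) n

/-- The inclusion constant set of the matrix jewel: those `s ∈ [0,1]^g` such that
inclusion at level one of the jewel in the free spectrahedron of a self-adjoint tuple `B` of
`d × d` matrices always implies inclusion at all levels, after the `(x, j)` coordinate
of the jewel is scaled by `s_x`. -/
def jewelInclusionSet {g : ℕ} (k : Fin g → ℕ) (d : ℕ) : Set (Fin g → ℝ) :=
  {s | (∀ x, s x ∈ Set.Icc (0 : ℝ) 1) ∧
    ∀ B : JewelIndex k → Matrix (Fin d) (Fin d) ℂ, (∀ i, (B i).IsHermitian) →
      matrixJewel k 1 ⊆ freeSpectrahedron B 1 →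
      ∀ n : ℕ, (fun X (i : JewelIndex k) => s i.1 • X i) '' matrixJewel k n ⊆
        freeSpectrahedron B n}

end Steering

end

open Steering

/-! Conjugation by σ̄^{-1/2} turns an ensemble (q_λ σ_λ) with average σ̄ into a POVM and leaves the
response functions p(a|x,λ) alone. So LHS models become parent POVMs, σ̄ / k_x becomes I / k_x, and
(0)–(2) follow. The left side of (3) then says that mixing with noise s makes every tuple of POVMs
compatible.

The jewel enters through `effectTuple`: B_{(x,j)} = ∑_e v_j(e) E_{e|x} = 2 E_{j|x} - (2/k_x) I.
Inclusion of the jewel in 𝒟_B at level one holds exactly when B comes from POVMs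
(`matrixJewel_one_subset_of_povm`, `exists_povm_of_matrixJewel_one_subset`). Compatibility gives
inclusion at every level, and inclusion at level d already gives compatibility
(`matrixJewel_subset_of_compatible`, `compatible_of_matrixJewel_subset`). Since the entries of v_j
sum to zero, white noise merely multiplies B_{(x,j)} by s_x, which is the scaling in the definition
of the inclusion set.

The hard step is producing a joint POVM (`exists_povm_of_diagonal_subset`). If none exists,
Hahn–Banach yields Y and X with Y - ∑ v_i(e) X_i > 0 for all e but tr Y < ∑ ⟨C_i, X_i⟩. Here Y > 0,
so Y^{-1/2} X Y^{-1/2} lies in the diagonal spectrahedron, hence in that of C; evaluating at the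
maximally entangled vector contradicts the strict inequality. -/

namespace Steering

/-! ### Assemblages and POVMs, LHS models and compatibility -/

section Correspondence

variable {g d : ℕ} {k : Fin g → ℕ} {avg : Matrix (Fin d) (Fin d) ℂ}

theorem isHermitian_sqrt (avg : Matrix (Fin d) (Fin d) ℂ) : (CFC.sqrt avg).IsHermitian :=
  (Matrix.nonneg_iff_posSemidef.1 (CFC.sqrt_nonneg avg)).isHermitian

theorem isUnit_sqrt (havg : avg.PosSemidef) (hinv : IsUnit avg) : IsUnit (CFC.sqrt avg) := by
  have h := CFC.sqrt_mul_sqrt_self avg (Matrix.nonneg_iff_posSemidef.2 havg)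
  rw [Matrix.isUnit_iff_isUnit_det] at hinv ⊢
  rw [← h, Matrix.det_mul] at hinv
  exact isUnit_of_mul_isUnit_left hinv

theorem sqrt_mul_inv (havg : avg.PosSemidef) (hinv : IsUnit avg) :
    CFC.sqrt avg * (CFC.sqrt avg)⁻¹ = 1 :=
  Matrix.mul_nonsing_inv _ ((Matrix.isUnit_iff_isUnit_det _).1 (isUnit_sqrt havg hinv))

theorem inv_mul_sqrt (havg : avg.PosSemidef) (hinv : IsUnit avg) :
    (CFC.sqrt avg)⁻¹ * CFC.sqrt avg = 1 :=
  Matrix.nonsing_inv_mul _ ((Matrix.isUnit_iff_isUnit_det _).1 (isUnit_sqrt havg hinv))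

theorem inv_sqrt_conj_self (havg : avg.PosSemidef) (hinv : IsUnit avg) :
    (CFC.sqrt avg)⁻¹ * avg * (CFC.sqrt avg)⁻¹ = 1 := by
  have h := CFC.sqrt_mul_sqrt_self avg (Matrix.nonneg_iff_posSemidef.2 havg)
  calc (CFC.sqrt avg)⁻¹ * avg * (CFC.sqrt avg)⁻¹
      = ((CFC.sqrt avg)⁻¹ * CFC.sqrt avg) * (CFC.sqrt avg * (CFC.sqrt avg)⁻¹) := by
        rw [mul_assoc, mul_assoc, ← mul_assoc (CFC.sqrt avg) (CFC.sqrt avg), h]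
    _ = 1 := by rw [sqrt_mul_inv havg hinv, inv_mul_sqrt havg hinv, one_mul]

theorem posSemidef_conj {S M : Matrix (Fin d) (Fin d) ℂ} (hS : S.IsHermitian)
    (hM : M.PosSemidef) : (S * M * S).PosSemidef := by
  simpa only [hS.eq] using hM.conjTranspose_mul_mul_same S

theorem toPOVM_mem (havg : avg.PosSemidef) (hinv : IsUnit avg) {σ : Family g k d}
    (hσ : σ ∈ assemblages k avg) : toPOVM avg σ ∈ povmTuples g k d := by
  refine fun x => ⟨fun a => posSemidef_conj (isHermitian_sqrt avg).inv (hσ.1 x a), ?_⟩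
  simp only [toPOVM]
  rw [← Finset.sum_mul, ← Finset.mul_sum, hσ.2 x, inv_sqrt_conj_self havg hinv]

theorem ofPOVM_mem (havg : avg.PosSemidef) {E : Family g k d}
    (hE : E ∈ povmTuples g k d) : ofPOVM avg E ∈ assemblages k avg := by
  refine ⟨fun x a => posSemidef_conj (isHermitian_sqrt avg) ((hE x).posSemidef a), fun x => ?_⟩
  simp only [ofPOVM]
  rw [← Finset.sum_mul, ← Finset.mul_sum, (hE x).sum_eq_one, mul_one,
    CFC.sqrt_mul_sqrt_self avg (Matrix.nonneg_iff_posSemidef.2 havg)]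

theorem sqrt_conj_inv_conj (havg : avg.PosSemidef) (hinv : IsUnit avg)
    (M : Matrix (Fin d) (Fin d) ℂ) :
    CFC.sqrt avg * ((CFC.sqrt avg)⁻¹ * M * (CFC.sqrt avg)⁻¹) * CFC.sqrt avg = M := by
  calc _ = (CFC.sqrt avg * (CFC.sqrt avg)⁻¹) * M * ((CFC.sqrt avg)⁻¹ * CFC.sqrt avg) := by
        simp only [mul_assoc]
    _ = M := by rw [sqrt_mul_inv havg hinv, inv_mul_sqrt havg hinv, one_mul, mul_one]

theorem inv_conj_sqrt_conj (havg : avg.PosSemidef) (hinv : IsUnit avg)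
    (M : Matrix (Fin d) (Fin d) ℂ) :
    (CFC.sqrt avg)⁻¹ * (CFC.sqrt avg * M * CFC.sqrt avg) * (CFC.sqrt avg)⁻¹ = M := by
  calc _ = ((CFC.sqrt avg)⁻¹ * CFC.sqrt avg) * M * (CFC.sqrt avg * (CFC.sqrt avg)⁻¹) := by
        simp only [mul_assoc]
    _ = M := by rw [sqrt_mul_inv havg hinv, inv_mul_sqrt havg hinv, one_mul, mul_one]

theorem ofPOVM_toPOVM (havg : avg.PosSemidef) (hinv : IsUnit avg) (σ : Family g k d) :
    ofPOVM avg (toPOVM avg σ) = σ := by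
  funext x a
  exact sqrt_conj_inv_conj havg hinv _

theorem toPOVM_ofPOVM (havg : avg.PosSemidef) (hinv : IsUnit avg) (E : Family g k d) :
    toPOVM avg (ofPOVM avg E) = E := by
  funext x a
  exact inv_conj_sqrt_conj havg hinv _

theorem toPOVM_mix (havg : avg.PosSemidef) (hinv : IsUnit avg) (s : Fin g → ℝ)
    (σ : Family g k d) :
    toPOVM avg (mix s σ (trivialAssemblage k avg)) = mix s (toPOVM avg σ) (whiteNoise k d) := by
  funext x a
  simp only [toPOVM, mix, trivialAssemblage, whiteNoise, mul_add, add_mul, mul_smul_comm,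
    smul_mul_assoc, inv_sqrt_conj_self havg hinv]

theorem ofPOVM_mix (havg : avg.PosSemidef) (s : Fin g → ℝ) (E : Family g k d) :
    ofPOVM avg (mix s E (whiteNoise k d)) = mix s (ofPOVM avg E) (trivialAssemblage k avg) := by
  funext x a
  simp only [ofPOVM, mix, trivialAssemblage, whiteNoise, mul_add, add_mul, mul_smul_comm,
    smul_mul_assoc, mul_one, CFC.sqrt_mul_sqrt_self avg (Matrix.nonneg_iff_posSemidef.2 havg)]

/-- Normalise M by its trace. A positive semidefinite matrix of trace zero vanishes, so any state,
here the spare `τ`, serves in that case. -/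
theorem exists_density_trace_smul_eq {M τ : Matrix (Fin d) (Fin d) ℂ} (hM : M.PosSemidef)
    (hτ : IsDensityMatrix τ) :
    0 ≤ M.trace.re ∧ ∃ ρ, IsDensityMatrix ρ ∧ M.trace.re • ρ = M := by
  have h0 : 0 ≤ M.trace := hM.trace_nonneg
  obtain ⟨hre, him⟩ := Complex.nonneg_iff.1 h0
  have htr : M.trace = (M.trace.re : ℂ) := Complex.ext (by simp) (by simp [← him])
  refine ⟨hre, ?_⟩
  by_cases h : M.trace.re = 0
  · refine ⟨τ, hτ, ?_⟩
    rw [h, zero_smul]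
    exact ((hM.trace_eq_zero_iff).1 (by rw [htr, h, Complex.ofReal_zero])).symm
  · refine ⟨(M.trace.re)⁻¹ • M, ⟨hM.smul (inv_nonneg.2 hre), ?_⟩, ?_⟩
    · rw [Matrix.trace_smul, htr, Complex.real_smul, Complex.ofReal_re, ← Complex.ofReal_mul,
        inv_mul_cancel₀ h, Complex.ofReal_one]
    · rw [smul_smul, mul_inv_cancel₀ h, one_smul]

/-- The weights are the traces of σ̄^{1/2} G_l σ̄^{1/2} and the hidden states its normalisations;
the weights add up to tr σ̄ = 1. -/
theorem exists_lhsModel_of_compatible (havg : IsDensityMatrix avg) (hinv : IsUnit avg)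
    {σ : Family g k d} (h : Compatible (toPOVM avg σ)) :
    ∃ (Λ : Type) (_ : Fintype Λ) (q : Λ → ℝ) (p : (x : Fin g) → Fin (k x) → Λ → ℝ)
      (τ : Λ → Matrix (Fin d) (Fin d) ℂ), IsLHSModel σ q p τ ∧ ∑ l, q l • τ l = avg := by
  obtain ⟨Λ, _, G, p, hG, hp, hE⟩ := h
  have hS := CFC.sqrt_mul_sqrt_self avg (Matrix.nonneg_iff_posSemidef.2 havg.posSemidef)
  have hM l : (CFC.sqrt avg * G l * CFC.sqrt avg).PosSemidef :=
    posSemidef_conj (isHermitian_sqrt avg) (hG.posSemidef l)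
  choose hq τ hτ hqτ using fun l => exists_density_trace_smul_eq (hM l) havg
  have hsum : ∑ l, (CFC.sqrt avg * G l * CFC.sqrt avg).trace.re • τ l = avg := by
    simp only [hqτ]
    rw [← Finset.sum_mul, ← Finset.mul_sum, hG.sum_eq_one, mul_one, hS]
  refine ⟨Λ, inferInstance, _, p, τ, ⟨hq, ?_, hp, hτ, fun x a => ?_⟩, hsum⟩
  · have h1 := congrArg (fun M => (Matrix.trace M).re) hsum
    simpa [Matrix.trace_sum, Matrix.trace_smul, (hτ _).trace_eq_one, havg.trace_eq_one] using h1
  · rw [← congrFun (congrFun (ofPOVM_toPOVM havg.posSemidef hinv σ) x) a]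
    simp only [ofPOVM, hE, mul_comm _ (p x a _), mul_smul, hqτ]
    simp only [Finset.mul_sum, Finset.sum_mul, mul_smul_comm, smul_mul_assoc]

theorem compatible_of_lhsModel (havg : avg.PosSemidef) (hinv : IsUnit avg)
    {σ : Family g k d} {Λ : Type} [Fintype Λ] {q : Λ → ℝ}
    {p : (x : Fin g) → Fin (k x) → Λ → ℝ} {τ : Λ → Matrix (Fin d) (Fin d) ℂ}
    (h : IsLHSModel σ q p τ) (hsum : ∑ l, q l • τ l = avg) : Compatible (toPOVM avg σ) := by
  refine ⟨Λ, inferInstance, fun l => (CFC.sqrt avg)⁻¹ * (q l • τ l) * (CFC.sqrt avg)⁻¹, p,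
    ⟨fun l => posSemidef_conj (isHermitian_sqrt avg).inv
      ((h.state l).posSemidef.smul (h.weight_nonneg l)), ?_⟩, h.condProb, fun x a => ?_⟩
  · rw [← Finset.sum_mul, ← Finset.mul_sum, hsum, inv_sqrt_conj_self havg hinv]
  · simp only [toPOVM, h.eq_sum, mul_comm (q _), mul_smul, Finset.mul_sum, Finset.sum_mul,
      mul_smul_comm, smul_mul_assoc]

theorem IsLHSModel.sum_eq {σ : Family g k d} {Λ : Type} [Fintype Λ] {q : Λ → ℝ}
    {p : (x : Fin g) → Fin (k x) → Λ → ℝ} {τ : Λ → Matrix (Fin d) (Fin d) ℂ}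
    (h : IsLHSModel σ q p τ) (x : Fin g) : ∑ a, σ x a = ∑ l, q l • τ l := by
  simp only [h.eq_sum]
  rw [Finset.sum_comm]
  refine Finset.sum_congr rfl fun l _ => ?_
  rw [← Finset.sum_smul, ← Finset.mul_sum, h.condProb.sum_eq_one, mul_one]

theorem hasLHSModel_iff_compatible (havg : IsDensityMatrix avg) (hinv : IsUnit avg)
    {σ : Family g k d} (hσ : σ ∈ assemblages k avg) :
    HasLHSModel σ ↔ Compatible (toPOVM avg σ) := by
  constructor
  · rintro ⟨Λ, _, q, p, τ, h⟩
    -- An LHS model fixes the ensemble average only through some marginal ∑_a σ_{a|x}. With no x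
    -- there is no such constraint, but compatibility is then vacuous.
    rcases Nat.eq_zero_or_pos g with rfl | hg
    · exact ⟨Unit, inferInstance, fun _ => 1, fun x => x.elim0,
        ⟨fun _ => Matrix.PosSemidef.one, by simp⟩, ⟨fun x => x.elim0, fun x => x.elim0⟩,
        fun x => x.elim0⟩
    · exact compatible_of_lhsModel havg.posSemidef hinv h
        ((h.sum_eq ⟨0, hg⟩).symm.trans (hσ.2 _))
  · intro h
    obtain ⟨Λ, _, q, p, τ, h, -⟩ := exists_lhsModel_of_compatible havg hinv h
    exact ⟨Λ, inferInstance, q, p, τ, h⟩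

theorem mem_lhsAssemblages_iff (havg : IsDensityMatrix avg) (hinv : IsUnit avg)
    {σ : Family g k d} (hσ : ∀ x a, (σ x a).PosSemidef) :
    σ ∈ lhsAssemblages k avg ↔ Compatible (toPOVM avg σ) := by
  constructor
  · rintro ⟨-, Λ, _, q, p, τ, h, hsum⟩
    exact compatible_of_lhsModel havg.posSemidef hinv h hsum
  · exact fun h => ⟨hσ, exists_lhsModel_of_compatible havg hinv h⟩

theorem mix_whiteNoise_mem (hk : ∀ x, 0 < k x) {s : Fin g → ℝ}
    (hs : ∀ x, s x ∈ Set.Icc (0 : ℝ) 1) {E : Family g k d} (hE : E ∈ povmTuples g k d) :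
    mix s E (whiteNoise k d) ∈ povmTuples g k d := by
  refine fun x => ⟨fun a => ((hE x).posSemidef a |>.smul (hs x).1).add
    ((Matrix.PosSemidef.one.smul (inv_nonneg.2 (Nat.cast_nonneg _))).smul
      (sub_nonneg.2 (hs x).2)), ?_⟩
  have hkx : (k x : ℝ) ≠ 0 := Nat.cast_ne_zero.2 (hk x).ne'
  simp only [mix, whiteNoise, Finset.sum_add_distrib, ← Finset.smul_sum, (hE x).sum_eq_one,
    Finset.sum_const, Finset.card_univ, Fintype.card_fin]
  rw [← Nat.cast_smul_eq_nsmul ℝ, smul_smul (k x : ℝ)⁻¹, inv_mul_cancel₀ hkx, one_smul, ← add_smul,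
    add_sub_cancel, one_smul]

theorem mix_image_subset_lhsAssemblages_iff (havg : IsDensityMatrix avg) (hinv : IsUnit avg)
    (hk : ∀ x, 0 < k x) {s : Fin g → ℝ} (hs : ∀ x, s x ∈ Set.Icc (0 : ℝ) 1) :
    (fun σ => mix s σ (trivialAssemblage k avg)) '' assemblages k avg ⊆ lhsAssemblages k avg ↔
      ∀ E ∈ povmTuples g k d, Compatible (mix s E (whiteNoise k d)) := by
  have hpos := havg.posSemidef
  constructor
  · intro h E hE
    have hmem := ofPOVM_mem hpos (mix_whiteNoise_mem hk hs hE)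
    have h1 := h ⟨_, ofPOVM_mem hpos hE, rfl⟩
    simp only [← ofPOVM_mix hpos] at h1
    rwa [mem_lhsAssemblages_iff havg hinv hmem.1, toPOVM_ofPOVM hpos hinv] at h1
  · rintro h _ ⟨σ, hσ, rfl⟩
    have hE := toPOVM_mem hpos hinv hσ
    have hmem := ofPOVM_mem hpos (mix_whiteNoise_mem hk hs hE)
    rw [ofPOVM_mix hpos, ofPOVM_toPOVM hpos hinv] at hmem
    rw [mem_lhsAssemblages_iff havg hinv hmem.1, toPOVM_mix hpos hinv]
    exact h _ hE

end Correspondence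

/-! ### Free spectrahedra of diagonal tuples -/

section Diagonal

variable {ι Ω : Type} [Fintype ι] [Fintype Ω] [DecidableEq Ω] {n d : ℕ}

theorem one_sub_sum_diagonal_kronecker (v : ι → Ω → ℝ) (X : ι → Matrix (Fin n) (Fin n) ℂ) :
    (1 : Matrix (Ω × Fin n) (Ω × Fin n) ℂ)
        - ∑ i, (Matrix.diagonal fun e => ((v i e : ℝ) : ℂ)) ⊗ₖ X i =
      ∑ e, Matrix.single e e (1 : ℂ) ⊗ₖ (1 - ∑ i, v i e • X i) := by
  ext ⟨e, a⟩ ⟨e', b⟩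
  simp only [Matrix.sub_apply, Matrix.sum_apply, Matrix.kroneckerMap_apply, Matrix.smul_apply,
    Matrix.single_apply, Matrix.diagonal_apply, Matrix.one_apply, Prod.mk.injEq]
  by_cases h : e = e'
  · subst h
    simp
  · rw [Finset.sum_eq_zero, Finset.sum_eq_zero]
    · simp [h]
    · intro f _
      rw [if_neg (by rintro ⟨rfl, rfl⟩; exact h rfl), zero_mul]
    · intro i _
      simp [h]

/-- For diagonal coefficients the matrix inequality is block diagonal, with one block for each e. -/
theorem mem_freeSpectrahedron_diagonal (v : ι → Ω → ℝ) (X : ι → Matrix (Fin n) (Fin n) ℂ) :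
    X ∈ freeSpectrahedron (fun i => Matrix.diagonal fun e => ((v i e : ℝ) : ℂ)) n ↔
      (∀ i, (X i).IsHermitian) ∧ ∀ e, (1 - ∑ i, v i e • X i).PosSemidef := by
  refine and_congr_right fun _ => ⟨fun h e => ?_, fun h => ?_⟩
  · have h1 := h.submatrix fun a : Fin n => (e, a)
    convert h1 using 1
    ext a b
    simp [Matrix.sum_apply, Matrix.one_apply]
  · rw [one_sub_sum_diagonal_kronecker]
    refine Matrix.posSemidef_sum _ fun e _ => ?_
    refine Matrix.PosSemidef.kronecker ?_ (h e)
    rw [← Matrix.diagonal_single]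
    exact Matrix.PosSemidef.diagonal (Pi.single_nonneg.2 zero_le_one)

/-- Because ∑ G_e = I, the defect I - ∑ C_i ⊗ X_i equals ∑_e G_e ⊗ (I - ∑_i v_i(e) X_i), a sum of
positive terms. -/
theorem mem_freeSpectrahedron_of_povm {v : ι → Ω → ℝ} {G : Ω → Matrix (Fin d) (Fin d) ℂ}
    (hG : IsPOVM G) {X : ι → Matrix (Fin n) (Fin n) ℂ}
    (hX : X ∈ freeSpectrahedron (fun i => Matrix.diagonal fun e => ((v i e : ℝ) : ℂ)) n) :
    X ∈ freeSpectrahedron (fun i => ∑ e, v i e • G e) n := by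
  rw [mem_freeSpectrahedron_diagonal] at hX
  refine ⟨hX.1, ?_⟩
  have h : (1 : Matrix (Fin d × Fin n) (Fin d × Fin n) ℂ) - ∑ i, (∑ e, v i e • G e) ⊗ₖ X i =
      ∑ e, G e ⊗ₖ (1 - ∑ i, v i e • X i) := by
    rw [← Matrix.one_kronecker_one, ← hG.sum_eq_one]
    ext ⟨a, a'⟩ ⟨b, b'⟩
    simp only [Matrix.sub_apply, Matrix.sum_apply, Matrix.kroneckerMap_apply, Matrix.smul_apply,
      Finset.sum_mul, mul_sub, Finset.sum_sub_distrib, Finset.mul_sum]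
    rw [Finset.sum_comm]
    simp only [Complex.real_smul]
    congr 1
    exact Finset.sum_congr rfl fun e _ => Finset.sum_congr rfl fun i _ => by ring
  rw [h]
  exact Matrix.posSemidef_sum _ fun e _ => (hG.posSemidef e).kronecker (hX.2 e)

end Diagonal

/-! ### Trace pairing and compactness -/

section Duality

variable {d : ℕ}

/-- The bilinear pairing `∑ a b, H a b * X a b` of square matrices. -/
noncomputable def entryPairing (H X : Matrix (Fin d) (Fin d) ℂ) : ℂ := ∑ a, ∑ b, H a b * X a b

theorem entryPairing_one (X : Matrix (Fin d) (Fin d) ℂ) : entryPairing 1 X = X.trace := by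
  simp [entryPairing, Matrix.one_apply, Matrix.trace]

theorem entryPairing_sum_left {ι : Type} (t : Finset ι) (H : ι → Matrix (Fin d) (Fin d) ℂ)
    (X : Matrix (Fin d) (Fin d) ℂ) :
    entryPairing (∑ i ∈ t, H i) X = ∑ i ∈ t, entryPairing (H i) X := by
  simp only [entryPairing, Matrix.sum_apply, Finset.sum_mul]
  rw [Finset.sum_comm]
  simp only [Finset.sum_comm (s := t)]
  exact Finset.sum_comm

/-- Pairing with rank-one positive matrices tests positivity of X. -/
theorem entryPairing_vecMulVec (w : Fin d → ℂ) (X : Matrix (Fin d) (Fin d) ℂ) :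
    entryPairing (Matrix.vecMulVec (star w) w) X = star w ⬝ᵥ X.mulVec w := by
  simp only [entryPairing, Matrix.vecMulVec_apply, dotProduct, Matrix.mulVec, Finset.mul_sum]
  exact Finset.sum_congr rfl fun a _ => Finset.sum_congr rfl fun b _ => by ring

theorem exists_map_eq_entryPairing (L : Matrix (Fin d) (Fin d) ℂ →ₗ[ℂ] ℂ) :
    ∃ X, ∀ H, L H = entryPairing H X := by
  refine ⟨Matrix.of fun a b => L (Matrix.single a b 1), fun H => ?_⟩
  conv_lhs => rw [Matrix.matrix_eq_sum_single H]
  simp only [map_sum, entryPairing, Matrix.of_apply]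
  refine Finset.sum_congr rfl fun a _ => Finset.sum_congr rfl fun b _ => ?_
  rw [← smul_eq_mul, ← map_smul, Matrix.smul_single, smul_eq_mul, mul_one]

/-- The Hermitian part `(X + Xᴴ) / 2` of a matrix. -/
noncomputable def hermitianPart (X : Matrix (Fin d) (Fin d) ℂ) : Matrix (Fin d) (Fin d) ℂ :=
  (2⁻¹ : ℝ) • (X + X.conjTranspose)

theorem isHermitian_hermitianPart (X : Matrix (Fin d) (Fin d) ℂ) :
    (hermitianPart X).IsHermitian := by
  simp [hermitianPart, Matrix.IsHermitian, Matrix.conjTranspose_smul, add_comm]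

/-- Lets the matrices representing a separating functional be replaced by Hermitian ones. -/
theorem re_entryPairing_hermitianPart {H : Matrix (Fin d) (Fin d) ℂ} (hH : H.IsHermitian)
    (X : Matrix (Fin d) (Fin d) ℂ) :
    (entryPairing H (hermitianPart X)).re = (entryPairing H X).re := by
  have h1 : entryPairing H X.conjTranspose = star (entryPairing H X) := by
    simp only [entryPairing, star_sum, star_mul', Matrix.conjTranspose_apply]
    rw [Finset.sum_comm]
    simp only [hH.apply]
  have h2 : entryPairing H (hermitianPart X) =
      2⁻¹ * (entryPairing H X + entryPairing H X.conjTranspose) := by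
    simp only [entryPairing, hermitianPart, Finset.mul_sum, ← Finset.sum_add_distrib,
      Matrix.smul_apply, Matrix.add_apply, Complex.real_smul]
    refine Finset.sum_congr rfl fun a _ => Finset.sum_congr rfl fun b _ => ?_
    push_cast
    ring
  rw [h2, h1]
  have h3 : (2⁻¹ : ℂ) = ((2⁻¹ : ℝ) : ℂ) := by norm_num
  rw [h3, Complex.re_ofReal_mul]
  simp
  ring

theorem exists_conjTranspose_mul_self {M : Matrix (Fin d) (Fin d) ℂ} (hM : M.PosSemidef) :
    ∃ B : Matrix (Fin d) (Fin d) ℂ, M = B.conjTranspose * B :=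
  CStarAlgebra.nonneg_iff_eq_star_mul_self.1 hM.nonneg

instance : LocallyConvexSpace ℝ (Matrix (Fin d) (Fin d) ℂ) :=
  inferInstanceAs (LocallyConvexSpace ℝ (Fin d → Fin d → ℂ))

theorem trace_conjTranspose_mul_self_re (B : Matrix (Fin d) (Fin d) ℂ) :
    (B.conjTranspose * B).trace.re = ∑ a, ∑ b, ‖B a b‖ ^ 2 := by
  rw [Finset.sum_comm]
  simp only [Matrix.trace, Matrix.diag_apply, Matrix.mul_apply, Matrix.conjTranspose_apply,
    Complex.re_sum]
  refine Finset.sum_congr rfl fun a _ => Finset.sum_congr rfl fun b _ => ?_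
  rw [← Complex.normSq_eq_norm_sq, Complex.normSq_apply]
  simp

/-- This set is the image of the Hilbert–Schmidt unit sphere under the continuous map B ↦ Bᴴ B. -/
theorem isCompact_setOf_sum_trace_eq_one (Ω : Type) [Fintype Ω] (d : ℕ) :
    IsCompact {G : Ω → Matrix (Fin d) (Fin d) ℂ |
      (∀ e, (G e).PosSemidef) ∧ ∑ e, (G e).trace.re = 1} := by
  let T : Set (Ω → Fin d → Fin d → ℂ) := {B | ∑ e, ∑ a, ∑ b, ‖B e a b‖ ^ 2 = 1}
  have hT : IsCompact T := by
    refine (isCompact_closedBall (0 : Ω → Fin d → Fin d → ℂ) 1).of_isClosed_subset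
      (isClosed_eq (by fun_prop) continuous_const) fun B hB => ?_
    rw [mem_closedBall_zero_iff]
    refine (pi_norm_le_iff_of_nonneg zero_le_one).2 fun e =>
      (pi_norm_le_iff_of_nonneg zero_le_one).2 fun a =>
      (pi_norm_le_iff_of_nonneg zero_le_one).2 fun b => ?_
    have h : ‖B e a b‖ ^ 2 ≤ 1 := by
      rw [← show _ = (1 : ℝ) from hB]
      refine le_trans ?_ (Finset.single_le_sum
        (f := fun e => ∑ a, ∑ b, ‖B e a b‖ ^ 2) (fun _ _ => by positivity) (Finset.mem_univ e))
      refine le_trans ?_ (Finset.single_le_sum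
        (f := fun a => ∑ b, ‖B e a b‖ ^ 2) (fun _ _ => by positivity) (Finset.mem_univ a))
      exact Finset.single_le_sum
        (f := fun b => ‖B e a b‖ ^ 2) (fun _ _ => by positivity) (Finset.mem_univ b)
    exact (sq_le_one_iff₀ (norm_nonneg _)).1 h
  let φ : (Ω → Matrix (Fin d) (Fin d) ℂ) → Ω → Matrix (Fin d) (Fin d) ℂ :=
    fun B e => (B e).conjTranspose * B e
  have hφ : Continuous φ := by
    refine continuous_pi fun e => ?_
    exact ((continuous_apply e).matrix_conjTranspose).matrix_mul (continuous_apply e)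
  convert IsCompact.image (f := φ) hT hφ using 1
  ext G
  constructor
  · rintro ⟨hG, htr⟩
    choose B hB using fun e => exists_conjTranspose_mul_self (hG e)
    refine ⟨B, ?_, funext fun e => (hB e).symm⟩
    simp only [hB, trace_conjTranspose_mul_self_re] at htr
    exact htr
  · rintro ⟨B, hB, rfl⟩
    refine ⟨fun e => Matrix.posSemidef_conjTranspose_mul_self _, ?_⟩
    simp only [φ, trace_conjTranspose_mul_self_re]
    exact hB

end Duality

/-! ### Separation and recovery of a joint POVM -/

section Duality

variable {ι Ω : Type} [Fintype ι] [Fintype Ω] {d : ℕ}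

theorem entryPairing_sum_right {κ : Type} (t : Finset κ) (H : Matrix (Fin d) (Fin d) ℂ)
    (X : κ → Matrix (Fin d) (Fin d) ℂ) :
    entryPairing H (∑ i ∈ t, X i) = ∑ i ∈ t, entryPairing H (X i) := by
  have h (A B : Matrix (Fin d) (Fin d) ℂ) : entryPairing A B = entryPairing B A := by
    simp only [entryPairing, mul_comm]
  simp only [h H, entryPairing_sum_left]

theorem entryPairing_smul_left (c : ℝ) (H X : Matrix (Fin d) (Fin d) ℂ) :
    entryPairing (c • H) X = c * entryPairing H X := by
  simp only [entryPairing, Finset.mul_sum, Matrix.smul_apply, Complex.real_smul, mul_assoc]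

theorem entryPairing_smul_right (c : ℝ) (H X : Matrix (Fin d) (Fin d) ℂ) :
    entryPairing H (c • X) = c * entryPairing H X := by
  simp only [entryPairing, Finset.mul_sum, Matrix.smul_apply, Complex.real_smul]
  exact Finset.sum_congr rfl fun a _ => Finset.sum_congr rfl fun b _ => by ring

theorem entryPairing_sub_right (H X Y : Matrix (Fin d) (Fin d) ℂ) :
    entryPairing H (X - Y) = entryPairing H X - entryPairing H Y := by
  simp only [entryPairing, Matrix.sub_apply, mul_sub, Finset.sum_sub_distrib]

theorem entryPairing_one_right (H : Matrix (Fin d) (Fin d) ℂ) :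
    entryPairing H 1 = H.trace := by
  simp [entryPairing, Matrix.one_apply, Matrix.trace]

theorem map_prod_pi_eq_entryPairing
    (L : Matrix (Fin d) (Fin d) ℂ × (ι → Matrix (Fin d) (Fin d) ℂ) →ₗ[ℂ] ℂ) :
    ∃ (X₀ : Matrix (Fin d) (Fin d) ℂ) (X : ι → Matrix (Fin d) (Fin d) ℂ), ∀ H₀ H,
      L (H₀, H) = entryPairing H₀ X₀ + ∑ i, entryPairing (H i) (X i) := by
  classical
  obtain ⟨X₀, hX₀⟩ := exists_map_eq_entryPairing (L ∘ₗ LinearMap.inl ℂ _ _)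
  choose X hX using fun i =>
    exists_map_eq_entryPairing (L ∘ₗ LinearMap.inr ℂ _ _ ∘ₗ LinearMap.single ℂ (fun _ : ι => Matrix (Fin d) (Fin d) ℂ) i)
  refine ⟨X₀, X, fun H₀ H => ?_⟩
  simp only [← hX₀, ← hX, LinearMap.comp_apply, ← map_sum, ← map_add]
  congr 1
  simp [Finset.univ_sum_single]

/-- If `C` is not of the form `∑ e, v i e • G e` with `G` a POVM, then it is strictly separated
from the set of all these tuples. -/
theorem exists_separating_of_not_exists_povm (hd : 0 < d) (v : ι → Ω → ℝ)
    (C : ι → Matrix (Fin d) (Fin d) ℂ) (hC : ∀ i, (C i).IsHermitian)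
    (h : ¬ ∃ G : Ω → Matrix (Fin d) (Fin d) ℂ, IsPOVM G ∧ ∀ i, C i = ∑ e, v i e • G e) :
    ∃ (Y : Matrix (Fin d) (Fin d) ℂ) (X : ι → Matrix (Fin d) (Fin d) ℂ),
      (∀ i, (X i).IsHermitian) ∧ (∀ e, (Y - ∑ i, v i e • X i).PosDef) ∧
      (entryPairing 1 Y).re < ∑ i, (entryPairing (C i) (X i)).re := by
  classical
  -- The achievable pairs form a convex cone. Separating from its compact base Φ(S), rather than
  -- from the cone, yields closedness for free and strict positivity below.
  let Φ : (Ω → Matrix (Fin d) (Fin d) ℂ) →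
      Matrix (Fin d) (Fin d) ℂ × (ι → Matrix (Fin d) (Fin d) ℂ) :=
    fun G => (∑ e, G e, fun i => ∑ e, v i e • G e)
  let S : Set (Ω → Matrix (Fin d) (Fin d) ℂ) :=
    {G | (∀ e, (G e).PosSemidef) ∧ ∑ e, (G e).trace.re = 1}
  have hΦ : Continuous Φ := by fun_prop
  have hΦlin : IsLinearMap ℝ Φ := by
    constructor
    · intro G G'
      refine Prod.ext ?_ (funext fun i => ?_)
      · simp [Φ, Finset.sum_add_distrib]
      · simp [Φ, Finset.sum_add_distrib]
    · intro c G
      refine Prod.ext ?_ (funext fun i => ?_)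
      · simp [Φ, Finset.smul_sum]
      · simp only [Φ, Pi.smul_apply, Prod.smul_snd, Finset.smul_sum, smul_comm c]
  have hS : IsCompact (Φ '' S) := (isCompact_setOf_sum_trace_eq_one Ω d).image hΦ
  have hconv : Convex ℝ (Φ '' S) := by
    refine Convex.is_linear_image ?_ hΦlin
    rintro G ⟨hG, htG⟩ G' ⟨hG', htG'⟩ a b ha hb hab
    refine ⟨fun e => ((hG e).smul ha).add ((hG' e).smul hb), ?_⟩
    simp only [Pi.add_apply, Pi.smul_apply, Matrix.trace_add, Matrix.trace_smul, Complex.add_re,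
      Complex.smul_re, Finset.sum_add_distrib, ← Finset.smul_sum, htG, htG']
    simpa using hab
  have hd' : (d : ℝ) ≠ 0 := Nat.cast_ne_zero.2 hd.ne'
  -- The trace normalisation in S turns ∑ G_e = I into ∑ G_e = I / d.
  have hnot : (d : ℝ)⁻¹ • (1, C) ∉ Φ '' S := by
    rintro ⟨G, ⟨hG, -⟩, hGC⟩
    refine h ⟨fun e => (d : ℝ) • G e, ⟨fun e => (hG e).smul (Nat.cast_nonneg _), ?_⟩, fun i => ?_⟩
    · rw [← Finset.smul_sum, show ∑ e, G e = _ from congrArg Prod.fst hGC]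
      simp [smul_smul, hd']
    · simp only [smul_comm _ (d : ℝ)]
      rw [← Finset.smul_sum,
        show ∑ e, v i e • G e = _ from congrFun (congrArg Prod.snd hGC) i]
      simp [smul_smul, hd']
  obtain ⟨F, u, hF, hFu⟩ :=
    RCLike.geometric_hahn_banach_closed_point (𝕜 := ℂ) hconv hS.isClosed hnot
  obtain ⟨X₀, X, hX⟩ := map_prod_pi_eq_entryPairing F.toLinearMap
  have hX' H₀ H : F (H₀, H) = entryPairing H₀ X₀ + ∑ i, entryPairing (H i) (X i) := hX H₀ H
  -- On matrices of trace one the threshold u is the pairing with u I, so it is absorbed into Y.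
  refine ⟨u • 1 - hermitianPart X₀, fun i => hermitianPart (X i),
    fun i => isHermitian_hermitianPart _, fun e => ?_, ?_⟩
  · have hherm : (u • 1 - hermitianPart X₀ - ∑ i, v i e • hermitianPart (X i)).IsHermitian := by
      refine ((Matrix.isHermitian_one.smul (IsSelfAdjoint.all u)).sub
        (isHermitian_hermitianPart _)).sub ?_
      exact isSelfAdjoint_sum _ fun i _ =>
        (isHermitian_hermitianPart (X i)).smul (IsSelfAdjoint.all (v i e))
    refine Matrix.PosDef.of_dotProduct_mulVec_pos hherm fun w hw => ?_
    let H := Matrix.vecMulVec (star w) w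
    have hH : H.PosSemidef := Matrix.posSemidef_vecMulVec_star_self w
    obtain ⟨t, ht, htr⟩ : ∃ t : ℝ, 0 < t ∧ H.trace = t := by
      obtain ⟨h1, h2⟩ := Complex.nonneg_iff.1 hH.trace_nonneg
      refine ⟨H.trace.re, lt_of_le_of_ne h1 fun h3 => hw ?_, Complex.ext rfl h2.symm⟩
      have h4 : H.trace = 0 := Complex.ext h3.symm h2.symm
      simpa [H, Matrix.trace_vecMulVec] using h4
    -- The test point is supported at the single outcome e, with a rank-one matrix of trace one.
    have hmem : Pi.single e (t⁻¹ • H) ∈ S := by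
      constructor
      · intro f
        rcases eq_or_ne f e with rfl | hf
        · simpa using hH.smul (inv_nonneg.2 ht.le)
        · simpa [hf] using Matrix.PosSemidef.zero
      · rw [Finset.sum_eq_single e (by intro f _ hf; simp [hf]) (by simp)]
        simp [Matrix.trace_smul, htr, ht.ne']
    have hlt := hF _ ⟨_, hmem, rfl⟩
    have hval : Φ (Pi.single e (t⁻¹ • H)) = (t⁻¹ • H, fun i => (t⁻¹ * v i e) • H) := by
      refine Prod.ext ?_ (funext fun i => ?_)
      · simp [Φ]
      · simp only [Φ]
        rw [Finset.sum_eq_single e (by intro f _ hf; simp [hf]) (by simp), Pi.single_eq_same,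
          smul_smul, mul_comm]
    simp only [hval, hX', entryPairing_smul_left, Complex.ofReal_mul, mul_assoc,
      ← Finset.mul_sum, ← mul_add, RCLike.re_eq_complex_re, Complex.re_ofReal_mul] at hlt
    rw [inv_mul_lt_iff₀ ht, Complex.add_re, Complex.re_sum] at hlt
    simp only [Complex.re_ofReal_mul] at hlt
    refine Complex.pos_iff.2 ⟨?_, ?_⟩
    · rw [← entryPairing_vecMulVec]
      change 0 < (entryPairing H _).re
      simp only [entryPairing_sub_right, entryPairing_sum_right, entryPairing_smul_right,
        entryPairing_one_right, htr, Complex.sub_re, Complex.re_sum, Complex.re_ofReal_mul,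
        re_entryPairing_hermitianPart hH.isHermitian, Complex.ofReal_re]
      linarith
    · exact (hherm.im_star_dotProduct_mulVec_self w).symm
  · have h1 : (entryPairing 1 (u • 1 - hermitianPart X₀)).re =
        u * d - (entryPairing 1 X₀).re := by
      rw [entryPairing_sub_right, Complex.sub_re,
        re_entryPairing_hermitianPart Matrix.isHermitian_one, entryPairing_smul_right,
        Complex.re_ofReal_mul, entryPairing_one]
      simp
    simp only [h1, re_entryPairing_hermitianPart (hC _)]
    rw [Prod.smul_mk, hX'] at hFu
    simp only [Pi.smul_apply, entryPairing_smul_left, ← Finset.mul_sum, ← mul_add,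
      RCLike.re_eq_complex_re, Complex.re_ofReal_mul] at hFu
    rw [lt_inv_mul_iff₀ (Nat.cast_pos.2 hd), Complex.add_re, Complex.re_sum] at hFu
    linarith

/-- If every `X` in the level `d` of the free spectrahedron of a tuple of diagonal matrices is
in that of `C`, then `C` is obtained from the diagonal entries by integrating against a POVM. -/
theorem exists_povm_of_diagonal_subset [DecidableEq Ω] [Nonempty Ω] (hd : 0 < d) (v : ι → Ω → ℝ)
    (hv : ∀ i, ∑ e, v i e = 0) (C : ι → Matrix (Fin d) (Fin d) ℂ) (hC : ∀ i, (C i).IsHermitian)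
    (hsub : freeSpectrahedron (fun i => Matrix.diagonal fun e => ((v i e : ℝ) : ℂ)) d ⊆
      freeSpectrahedron C d) :
    ∃ G : Ω → Matrix (Fin d) (Fin d) ℂ, IsPOVM G ∧ ∀ i, C i = ∑ e, v i e • G e := by
  by_contra hcon
  obtain ⟨Y, X, hXh, hpos, hlt⟩ := exists_separating_of_not_exists_povm hd v C hC hcon
  -- Summing over e cancels the X terms, as each v_i has zero sum.
  have hY : Y.PosDef := by
    have h1 := Matrix.posDef_sum Finset.univ_nonempty fun e (_ : e ∈ Finset.univ) => hpos e
    have h2 : ∑ e, (Y - ∑ i, v i e • X i) = (Fintype.card Ω : ℝ) • Y := by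
      rw [Finset.sum_sub_distrib, Finset.sum_comm]
      simp only [← Finset.sum_smul, hv, zero_smul, Finset.sum_const_zero, sub_zero,
        Finset.sum_const, Finset.card_univ, Nat.cast_smul_eq_nsmul]
    rw [h2] at h1
    have hc : (0 : ℝ) < Fintype.card Ω := Nat.cast_pos.2 Fintype.card_pos
    have h3 := h1.smul (inv_pos.2 hc)
    rwa [smul_smul, inv_mul_cancel₀ hc.ne', one_smul] at h3
  have hYs := hY.posSemidef
  have hYu := hY.isUnit
  set R := (CFC.sqrt Y)⁻¹ with hR
  have hRh : R.IsHermitian := (isHermitian_sqrt Y).inv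
  have hmem : (fun i => R * X i * R) ∈ freeSpectrahedron C d := by
    refine hsub ((mem_freeSpectrahedron_diagonal v _).2 ⟨fun i => ?_, fun e => ?_⟩)
    · simpa only [hRh.eq] using Matrix.isHermitian_conjTranspose_mul_mul R (hXh i)
    · have h1 := posSemidef_conj hRh (hpos e).posSemidef
      rw [mul_sub, sub_mul, hR, inv_sqrt_conj_self hYs hYu] at h1
      simpa only [Finset.mul_sum, Finset.sum_mul, mul_smul_comm, smul_mul_assoc] using h1
  -- Undoing the conjugation on the second factor gives I ⊗ Y - ∑ C_i ⊗ X_i ≥ 0.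
  have h1 := hmem.2.conjTranspose_mul_mul_same ((1 : Matrix (Fin d) (Fin d) ℂ) ⊗ₖ CFC.sqrt Y)
  have hsq : ((1 : Matrix (Fin d) (Fin d) ℂ) ⊗ₖ CFC.sqrt Y).conjTranspose =
      (1 : Matrix (Fin d) (Fin d) ℂ) ⊗ₖ CFC.sqrt Y := by
    rw [Matrix.conjTranspose_kronecker, Matrix.conjTranspose_one, (isHermitian_sqrt Y).eq]
  rw [hsq, mul_sub, sub_mul, mul_one, ← Matrix.mul_kronecker_mul, one_mul, Finset.mul_sum,
    Finset.sum_mul, CFC.sqrt_mul_sqrt_self Y (Matrix.nonneg_iff_posSemidef.2 hYs)] at h1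
  simp only [← Matrix.mul_kronecker_mul, one_mul, mul_one, hR, sqrt_conj_inv_conj hYs hYu] at h1
  -- The unnormalised maximally entangled vector ∑ e_a ⊗ e_a satisfies ⟨ω, (A ⊗ B) ω⟩ =
  -- `entryPairing A B`.
  have h2 := h1.dotProduct_mulVec_nonneg fun p => if p.1 = p.2 then 1 else 0
  have h3 (A B : Matrix (Fin d) (Fin d) ℂ) :
      star (fun p : Fin d × Fin d => if p.1 = p.2 then (1 : ℂ) else 0) ⬝ᵥ
        (A ⊗ₖ B).mulVec (fun p => if p.1 = p.2 then 1 else 0) = entryPairing A B := by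
    simp [dotProduct, Matrix.mulVec, Fintype.sum_prod_type, entryPairing, apply_ite]
  rw [Matrix.sub_mulVec, dotProduct_sub, Matrix.sum_mulVec, dotProduct_sum] at h2
  simp only [h3] at h2
  have h4 := (Complex.nonneg_iff.1 h2).1
  rw [Complex.sub_re, Complex.re_sum] at h4
  linarith

end Duality

/-! ### Linear algebra of the jewel vectors -/

section JewelVec

theorem sum_jewelVec_smul {V : Type*} [AddCommGroup V] [Module ℝ V] {r : ℕ} (j : Fin (r - 1))
    (f : Fin r → V) :
    ∑ e, jewelVec r j e • f e =
      (2 : ℝ) • f ⟨j, j.isLt.trans_le (Nat.sub_le r 1)⟩ - (2 / (r : ℝ)) • ∑ e, f e := by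
  simp only [jewelVec, add_smul, neg_smul, Finset.sum_add_distrib, ite_smul, zero_smul,
    Finset.sum_neg_distrib, ← Finset.smul_sum]
  rw [Finset.sum_eq_single ⟨j, j.isLt.trans_le (Nat.sub_le r 1)⟩
    (fun e _ he => if_neg fun h => he (Fin.ext h)) (by simp), if_pos rfl]
  abel

theorem sum_jewelVec {r : ℕ} (hr : 0 < r) (j : Fin (r - 1)) : ∑ e, jewelVec r j e = 0 := by
  have h := sum_jewelVec_smul j fun _ => (1 : ℝ)
  have hr' : (r : ℝ) ≠ 0 := Nat.cast_ne_zero.2 hr.ne'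
  simpa [hr'] using h

/-- The pairing with v_j and the total determine the j-th entry; the last entry, which has no v_j,
is the total minus the others. -/
theorem eq_of_sum_jewelVec_smul_eq {V : Type*} [AddCommGroup V] [Module ℝ V] {r : ℕ}
    {f f' : Fin r → V} (hsum : ∑ e, f e = ∑ e, f' e)
    (h : ∀ j, ∑ e, jewelVec r j e • f e = ∑ e, jewelVec r j e • f' e) : f = f' := by
  rcases r with _ | m
  · exact funext fun e => e.elim0
  · have h1 (j : Fin m) : f j.castSucc = f' j.castSucc := by
      have h2 := h j
      rw [sum_jewelVec_smul, sum_jewelVec_smul, hsum, sub_left_inj] at h2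
      exact smul_right_injective V (two_ne_zero (α := ℝ)) h2
    rw [Fin.sum_univ_castSucc, Fin.sum_univ_castSucc, Finset.sum_congr rfl fun j _ => h1 j,
      add_right_inj] at hsum
    exact funext fun e => Fin.lastCases hsum h1 e

/-- The coefficients `t_j` for which `∑ j, t_j v_j` has `e`-th entry `1 - r` and all other
entries `1`. -/
noncomputable def jewelDual (r e j : ℕ) : ℝ :=
  (r / 2 : ℝ) * ((if e = r - 1 then 1 else 0) - if e = j then 1 else 0)

theorem sum_jewelDual {r : ℕ} (j : Fin (r - 1)) :
    ∑ e : Fin r, jewelDual r e j = 0 := by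
  have hj := j.isLt
  simp only [jewelDual, ← Finset.mul_sum, Finset.sum_sub_distrib]
  rw [Finset.sum_eq_single ⟨r - 1, by omega⟩
    (fun e _ he => if_neg fun h => he (Fin.ext h)) (by simp),
    Finset.sum_eq_single ⟨j, by omega⟩
    (fun e _ he => if_neg fun h => he (Fin.ext h)) (by simp)]
  simp

/-- Biorthogonality up to the factor -r; it shows that the effects built from B by `jewelDual` give
B back. -/
theorem sum_jewelVec_mul_jewelDual {r : ℕ} (i j : Fin (r - 1)) :
    ∑ e, jewelVec r i e * jewelDual r e j = if i = j then -(r : ℝ) else 0 := by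
  have h := sum_jewelVec_smul i fun e : Fin r => jewelDual r e j
  simp only [smul_eq_mul] at h
  rw [h, sum_jewelDual, mul_zero, sub_zero, jewelDual]
  have hi : (i : ℕ) ≠ r - 1 := i.isLt.ne
  simp only [if_neg hi, ← Fin.ext_iff]
  split_ifs <;> ring

/-- For e < r - 1 the only nonzero coefficient is t_e = -r/2; for e = r - 1 all coefficients equal
r/2. -/
theorem sum_jewelDual_mul_jewelVec {r : ℕ} (e e' : Fin r) :
    ∑ j : Fin (r - 1), jewelDual r e j * jewelVec r j e' = 1 - if e = e' then (r : ℝ) else 0 := by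
  rcases r with _ | m
  · exact e.elim0
  have hr : ((m + 1 : ℕ) : ℝ) ≠ 0 := Nat.cast_ne_zero.2 m.succ_ne_zero
  change ∑ j : Fin m, jewelDual (m + 1) e j * jewelVec (m + 1) j e' = _
  have h1 (c : Fin (m + 1)) : ∑ j : Fin m, (if (c : ℕ) = (j : ℕ) then (1 : ℝ) else 0) =
      if c = Fin.last m then 0 else 1 := by
    refine Fin.lastCases ?_ (fun i => ?_) c
    · rw [if_pos rfl]
      exact Finset.sum_eq_zero fun j _ => if_neg j.isLt.ne'
    · rw [if_neg (Fin.castSucc_lt_last i).ne]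
      simp [Fin.val_inj]
  have h2 : ∑ j : Fin m, (if (e : ℕ) = (j : ℕ) then (1 : ℝ) else 0) *
      (if (e' : ℕ) = (j : ℕ) then (1 : ℝ) else 0) =
      if e = e' then (if e = Fin.last m then 0 else 1) else 0 := by
    split_ifs with h h'
    · subst h h'
      exact Finset.sum_eq_zero fun j _ => by
        rw [if_neg (show ((Fin.last m : Fin (m + 1)) : ℕ) ≠ j from j.isLt.ne'), zero_mul]
    · subst h
      have := h1 e
      rw [if_neg h'] at this
      refine Eq.trans ?_ this
      exact Finset.sum_congr rfl fun j _ => by split_ifs <;> simp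
    · refine Finset.sum_eq_zero fun j _ => ?_
      split_ifs with h3 h4
      · exact absurd (Fin.ext (h3.trans h4.symm)) h
      all_goals simp
  have hlast (c : Fin (m + 1)) : (c : ℕ) = m + 1 - 1 ↔ c = Fin.last m := by
    rw [Fin.ext_iff]; rfl
  have h3 (j : Fin m) : jewelDual (m + 1) e j * jewelVec (m + 1) j e' =
      (-(if e = Fin.last m then 1 else 0) + (if (e : ℕ) = (j : ℕ) then 1 else 0)
        + (m + 1 : ℕ) * (if e = Fin.last m then 1 else 0) *
          (if (e' : ℕ) = (j : ℕ) then 1 else 0))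
        - (m + 1 : ℕ) * ((if (e : ℕ) = (j : ℕ) then 1 else 0) *
          (if (e' : ℕ) = (j : ℕ) then 1 else 0)) := by
    simp only [jewelDual, jewelVec, hlast]
    rw [show (if (e' : ℕ) = (j : ℕ) then (2 : ℝ) else 0) =
      2 * (if (e' : ℕ) = (j : ℕ) then 1 else 0) by split_ifs <;> simp]
    field_simp
    ring
  simp only [h3, Finset.sum_sub_distrib, Finset.sum_add_distrib, ← Finset.mul_sum, h1, h2,
    Finset.sum_const, Finset.card_univ, Fintype.card_fin, nsmul_eq_mul]
  push_cast
  by_cases ha : e = Fin.last m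
  · by_cases hb : e' = Fin.last m
    · subst ha hb
      simp
    · have hne : e ≠ e' := fun h => hb (h ▸ ha)
      simp [ha, hb, ha ▸ hne]
  · by_cases hb : e = e'
    · simp [hb, hb ▸ ha]
    · simp [ha, hb]

end JewelVec

/-! ### The matrix jewel and effect tuples -/

section Jewel

variable {g d : ℕ} {k : Fin g → ℕ}

/-- The tuple `B_{(x,j)} = 2 E_{j|x} - (2 / k_x) I` associated with effects `E`. -/
noncomputable def effectTuple (E : Family g k d) (i : JewelIndex k) :
    Matrix (Fin d) (Fin d) ℂ :=
  ∑ e, jewelVec (k i.1) i.2 e • E i.1 e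

theorem isHermitian_effectTuple {E : Family g k d} (hE : E ∈ povmTuples g k d)
    (i : JewelIndex k) : (effectTuple E i).IsHermitian :=
  isSelfAdjoint_sum _ fun e _ => ((hE i.1).posSemidef e).isHermitian.smul
    (IsSelfAdjoint.all (jewelVec (k i.1) i.2 e))

theorem effectTuple_mix (hk : ∀ x, 0 < k x) (s : Fin g → ℝ) (E : Family g k d)
    (i : JewelIndex k) :
    effectTuple (mix s E (whiteNoise k d)) i = s i.1 • effectTuple E i := by
  simp only [effectTuple, mix, whiteNoise, smul_add, Finset.sum_add_distrib, ← Finset.sum_smul,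
    sum_jewelVec (hk i.1), zero_smul, add_zero, Finset.smul_sum, smul_comm (s i.1)]

theorem smul_image_subset_iff (s : Fin g → ℝ) (B : JewelIndex k → Matrix (Fin d) (Fin d) ℂ)
    (n : ℕ) :
    (fun X (i : JewelIndex k) => s i.1 • X i) '' matrixJewel k n ⊆ freeSpectrahedron B n ↔
      matrixJewel k n ⊆ freeSpectrahedron (fun i => s i.1 • B i) n := by
  rw [Set.image_subset_iff]
  refine forall₂_congr fun X hX => ?_
  simp only [Set.mem_preimage, freeSpectrahedron, Set.mem_ofPred_eq, Matrix.kronecker_smul,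
    Matrix.smul_kronecker]
  exact and_congr_left fun _ => iff_of_true
    (fun i => (hX.1 i).smul (IsSelfAdjoint.all (s i.1))) hX.1

theorem matrixJewel_eq (n : ℕ) : matrixJewel k n =
    freeSpectrahedron (fun i : JewelIndex k => Matrix.diagonal fun ε : (x : Fin g) → Fin (k x) =>
      ((jewelVec (k i.1) i.2 (ε i.1) : ℝ) : ℂ)) n :=
  rfl

theorem mem_matrixJewel {n : ℕ} {X : JewelIndex k → Matrix (Fin n) (Fin n) ℂ} :
    X ∈ matrixJewel k n ↔ (∀ i, (X i).IsHermitian) ∧ ∀ ε : (x : Fin g) → Fin (k x),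
      (1 - ∑ i : JewelIndex k, jewelVec (k i.1) i.2 (ε i.1) • X i).PosSemidef := by
  rw [matrixJewel_eq]
  exact mem_freeSpectrahedron_diagonal
    (fun (i : JewelIndex k) (ε : (x : Fin g) → Fin (k x)) => jewelVec (k i.1) i.2 (ε i.1)) X

/-! ### Inclusion at level one and POVMs -/

theorem smul_one_mem_matrixJewel_one {t : JewelIndex k → ℝ}
    (ht : ∀ ε : (x : Fin g) → Fin (k x), ∑ i : JewelIndex k, jewelVec (k i.1) i.2 (ε i.1) * t i ≤ 1) :
    (fun i => t i • (1 : Matrix (Fin 1) (Fin 1) ℂ)) ∈ matrixJewel k 1 := by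
  refine mem_matrixJewel.2
    ⟨fun i => Matrix.isHermitian_one.smul (IsSelfAdjoint.all (t i)), fun ε => ?_⟩
  simp only [smul_smul, ← Finset.sum_smul]
  have h := Matrix.PosSemidef.one (n := Fin 1) (R := ℂ) |>.smul (sub_nonneg.2 (ht ε))
  rwa [sub_smul, one_smul] at h

theorem exists_smul_one_of_mem_matrixJewel_one {X : JewelIndex k → Matrix (Fin 1) (Fin 1) ℂ}
    (hX : X ∈ matrixJewel k 1) :
    ∃ t : JewelIndex k → ℝ, X = (fun i => t i • 1) ∧
      ∀ ε : (x : Fin g) → Fin (k x), ∑ i : JewelIndex k, jewelVec (k i.1) i.2 (ε i.1) * t i ≤ 1 := by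
  obtain ⟨hh, hpos⟩ := mem_matrixJewel.1 hX
  have hXt : X = fun i => (X i 0 0).re • 1 := by
    funext i
    ext a b
    rw [Subsingleton.elim a 0, Subsingleton.elim b 0]
    simpa using ((hh i).coe_re_apply_self 0).symm
  refine ⟨fun i => (X i 0 0).re, hXt, fun ε => ?_⟩
  have h := (Complex.nonneg_iff.1 ((hpos ε).diag_nonneg (i := 0))).1
  simp only [Matrix.sub_apply, Matrix.one_apply_eq, Matrix.sum_apply, Matrix.smul_apply,
    Complex.sub_re, Complex.one_re, Complex.re_sum, Complex.smul_re, smul_eq_mul] at h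
  linarith

theorem smul_one_mem_freeSpectrahedron_one_iff {ι : Type} [Fintype ι]
    {B : ι → Matrix (Fin d) (Fin d) ℂ} {t : ι → ℝ} :
    (fun i => t i • (1 : Matrix (Fin 1) (Fin 1) ℂ)) ∈ freeSpectrahedron B 1 ↔
      (1 - ∑ i, t i • B i).PosSemidef := by
  have h : (1 : Matrix (Fin d × Fin 1) (Fin d × Fin 1) ℂ)
      - ∑ i, B i ⊗ₖ (t i • (1 : Matrix (Fin 1) (Fin 1) ℂ)) =
      (1 - ∑ i, t i • B i) ⊗ₖ (1 : Matrix (Fin 1) (Fin 1) ℂ) := by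
    ext ⟨a, a'⟩ ⟨b, b'⟩
    simp [Matrix.sum_apply, Matrix.one_apply, Subsingleton.elim a' b', mul_comm]
  constructor
  · intro hmem
    have h1 := hmem.2
    rw [h] at h1
    convert h1.submatrix fun a : Fin d => (a, (0 : Fin 1)) using 1
    ext a b
    simp
  · exact fun hpos => ⟨fun i => Matrix.isHermitian_one.smul (IsSelfAdjoint.all (t i)),
      h ▸ hpos.kronecker Matrix.PosSemidef.one⟩

/-- With m_x(e) = ∑_j v_j(e) t_{(x,j)}, the jewel condition at the choice ε maximising each m_x
reads ∑_x max m_x ≤ 1. The defect is (1 - ∑_x max m_x) I + ∑_{x,e} (max m_x - m_x(e)) E_{e|x}. -/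
theorem matrixJewel_one_subset_of_povm (hk : ∀ x, 0 < k x) {E : Family g k d}
    (hE : E ∈ povmTuples g k d) :
    matrixJewel k 1 ⊆ freeSpectrahedron (effectTuple E) 1 := by
  intro X hX
  obtain ⟨t, rfl, ht⟩ := exists_smul_one_of_mem_matrixJewel_one hX
  rw [smul_one_mem_freeSpectrahedron_one_iff]
  let m : (x : Fin g) → Fin (k x) → ℝ := fun x e => ∑ j, jewelVec (k x) j e * t ⟨x, j⟩
  have hmax (x : Fin g) : ∃ e, ∀ e', m x e' ≤ m x e :=
    have : Nonempty (Fin (k x)) := ⟨⟨0, hk x⟩⟩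
    Finite.exists_max (m x)
  choose ε hε using hmax
  have h1 : ∑ x, m x (ε x) ≤ 1 := by
    simpa only [m, Fintype.sum_sigma] using ht ε
  have h2 : 1 - ∑ i, t i • effectTuple E i =
      (1 - ∑ x, m x (ε x)) • (1 : Matrix (Fin d) (Fin d) ℂ) +
        ∑ x, ∑ e, (m x (ε x) - m x e) • E x e := by
    have h3 : ∑ i, t i • effectTuple E i = ∑ x, ∑ e, m x e • E x e := by
      simp only [effectTuple, Fintype.sum_sigma, m, Finset.smul_sum, Finset.sum_smul, smul_smul,
        mul_comm (t _)]
      refine Finset.sum_congr rfl fun x _ => ?_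
      rw [Finset.sum_comm]
    simp only [h3, sub_smul, Finset.sum_sub_distrib, ← Finset.smul_sum, (hE _).sum_eq_one,
      Finset.sum_smul, one_smul]
    abel
  rw [h2]
  exact (Matrix.PosSemidef.one.smul (sub_nonneg.2 h1)).add <|
    Matrix.posSemidef_sum _ fun x _ => Matrix.posSemidef_sum _ fun e _ =>
      ((hE x).posSemidef e).smul (sub_nonneg.2 (hε x e))

theorem exists_povm_of_matrixJewel_one_subset (hk : ∀ x, 0 < k x)
    {B : JewelIndex k → Matrix (Fin d) (Fin d) ℂ}
    (hB : matrixJewel k 1 ⊆ freeSpectrahedron B 1) :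
    ∃ E ∈ povmTuples g k d, effectTuple E = B := by
  have hk' (x : Fin g) : (k x : ℝ) ≠ 0 := Nat.cast_ne_zero.2 (hk x).ne'
  let E : Family g k d := fun x e =>
    (k x : ℝ)⁻¹ • (1 - ∑ j : Fin (k x - 1), jewelDual (k x) e j • B ⟨x, j⟩)
  refine ⟨E, fun x => ⟨fun e => ?_, ?_⟩, funext fun i => ?_⟩
  · let t : JewelIndex k → ℝ := fun i => if i.1 = x then jewelDual (k x) e i.2 else 0
    have ht (ε : (x : Fin g) → Fin (k x)) :
        ∑ i : JewelIndex k, jewelVec (k i.1) i.2 (ε i.1) * t i ≤ 1 := by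
      rw [Fintype.sum_sigma, Finset.sum_eq_single x
        (fun y _ hy => Finset.sum_eq_zero fun j _ => by simp [t, hy]) (by simp)]
      simp only [t, if_true, mul_comm (jewelVec _ _ _), sum_jewelDual_mul_jewelVec]
      split_ifs <;> simp
    have h := smul_one_mem_freeSpectrahedron_one_iff.1 (hB (smul_one_mem_matrixJewel_one ht))
    rw [Fintype.sum_sigma, Finset.sum_eq_single x
        (fun y _ hy => Finset.sum_eq_zero fun j _ => by simp [t, hy]) (by simp)] at h
    simp only [t, if_true] at h
    exact h.smul (inv_nonneg.2 (Nat.cast_nonneg _))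
  · simp only [E, ← Finset.smul_sum, Finset.sum_sub_distrib]
    rw [Finset.sum_comm]
    simp only [← Finset.sum_smul, sum_jewelDual, zero_smul, Finset.sum_const_zero, sub_zero,
      Finset.sum_const, Finset.card_univ, Fintype.card_fin]
    rw [← Nat.cast_smul_eq_nsmul ℝ, smul_smul, inv_mul_cancel₀ (hk' x), one_smul]
  · obtain ⟨x, i⟩ := i
    simp only [effectTuple, E, smul_comm _ (k x : ℝ)⁻¹, ← Finset.smul_sum, smul_sub,
      Finset.sum_sub_distrib, ← Finset.sum_smul, sum_jewelVec (hk x), zero_smul, smul_zero, zero_sub]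
    simp only [Finset.smul_sum, smul_smul]
    rw [Finset.sum_comm]
    simp only [← Finset.sum_smul, ← Finset.mul_sum, sum_jewelVec_mul_jewelDual]
    rw [Finset.sum_eq_single i (fun j _ hj => by simp [hj.symm]) (by simp), if_pos rfl,
      mul_neg, inv_mul_cancel₀ (hk' x), neg_smul, one_smul, neg_neg]

/-! ### Joint measurability and inclusion at higher levels -/

theorem sum_mul_prod_eq {p : (x : Fin g) → Fin (k x) → ℝ} (hp : ∀ x, ∑ a, p x a = 1)
    (x : Fin g) (f : Fin (k x) → ℝ) :
    ∑ ε : (y : Fin g) → Fin (k y), f (ε x) * ∏ y, p y (ε y) = ∑ a, f a * p x a := by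
  -- Absorbing f into the x-th factor leaves a product, whose sum factorises.
  have h (ε : (y : Fin g) → Fin (k y)) : f (ε x) * ∏ y, p y (ε y) =
      ∏ y, Function.update p x (fun a => f a * p x a) y (ε y) := by
    rw [← Finset.mul_prod_erase _ _ (Finset.mem_univ x),
      ← Finset.mul_prod_erase _ (fun y => Function.update p x _ y (ε y)) (Finset.mem_univ x),
      Function.update_self, mul_assoc]
    congr 2
    refine Finset.prod_congr rfl fun y hy => ?_
    rw [Function.update_of_ne (Finset.ne_of_mem_erase hy)]
  simp only [h]
  rw [← Fintype.piFinset_univ, ← Finset.prod_univ_sum, Finset.prod_eq_single x _ (by simp)]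
  · rw [Function.update_self]
  · intro y _ hy
    rw [Function.update_of_ne hy, hp]

/-- Drawing all outcomes independently given l moves the randomness into the parent POVM, G_ε = ∑_l
∏_y p(ε_y|y,l) G_l, so that the post-processing just reads off ε_x. -/
theorem compatible_iff_exists_joint (E : Family g k d) :
    Compatible E ↔ ∃ G : ((x : Fin g) → Fin (k x)) → Matrix (Fin d) (Fin d) ℂ, IsPOVM G ∧
      ∀ x a, E x a = ∑ ε, (if ε x = a then (1 : ℝ) else 0) • G ε := by
  constructor
  · rintro ⟨Λ, _, G, p, hG, hp, hE⟩
    refine ⟨fun ε => ∑ l, (∏ y, p y (ε y) l) • G l, ⟨fun ε => ?_, ?_⟩, fun x a => ?_⟩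
    · exact Matrix.posSemidef_sum _ fun l _ =>
        (hG.posSemidef l).smul (Finset.prod_nonneg fun y _ => hp.nonneg y _ l)
    · rw [Finset.sum_comm, ← hG.sum_eq_one]
      refine Finset.sum_congr rfl fun l _ => ?_
      rw [← Finset.sum_smul, ← Fintype.piFinset_univ,
        ← Finset.prod_univ_sum (f := fun y a => p y a l)]
      simp [hp.sum_eq_one]
    · simp only [Finset.smul_sum, smul_smul]
      rw [hE, Finset.sum_comm]
      refine Finset.sum_congr rfl fun l _ => ?_
      rw [← Finset.sum_smul, sum_mul_prod_eq (p := fun y a => p y a l)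
        (fun y => hp.sum_eq_one y l) x fun b => if b = a then 1 else 0]
      simp
  · rintro ⟨G, hG, hE⟩
    refine ⟨_, inferInstance, G, fun x a ε => if ε x = a then 1 else 0, hG,
      ⟨fun x a ε => ?_, fun x ε => by simp⟩, hE⟩
    split_ifs <;> norm_num

theorem effectTuple_eq_of_joint {E : Family g k d}
    {G : ((x : Fin g) → Fin (k x)) → Matrix (Fin d) (Fin d) ℂ}
    (hE : ∀ x a, E x a = ∑ ε, (if ε x = a then (1 : ℝ) else 0) • G ε) (i : JewelIndex k) :
    effectTuple E i = ∑ ε, jewelVec (k i.1) i.2 (ε i.1) • G ε := by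
  simp only [effectTuple, hE, Finset.smul_sum, smul_smul]
  rw [Finset.sum_comm]
  simp only [← Finset.sum_smul]
  simp

theorem matrixJewel_subset_of_compatible {E : Family g k d} (h : Compatible E) (n : ℕ) :
    matrixJewel k n ⊆ freeSpectrahedron (effectTuple E) n := by
  obtain ⟨G, hG, hE⟩ := (compatible_iff_exists_joint E).1 h
  rw [funext (effectTuple_eq_of_joint hE)]
  exact fun X hX => mem_freeSpectrahedron_of_povm hG hX

theorem compatible_of_matrixJewel_subset (hd : 0 < d) (hk : ∀ x, 0 < k x) {E : Family g k d}
    (hE : E ∈ povmTuples g k d)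
    (h : matrixJewel k d ⊆ freeSpectrahedron (effectTuple E) d) : Compatible E := by
  have : Nonempty ((x : Fin g) → Fin (k x)) := ⟨fun x => ⟨0, hk x⟩⟩
  -- Up to a nonzero constant this is the mean of v_j under the uniform product distribution.
  have hv (i : JewelIndex k) :
      ∑ ε : (x : Fin g) → Fin (k x), jewelVec (k i.1) i.2 (ε i.1) = 0 := by
    have h1 := sum_mul_prod_eq (k := k) (p := fun x _ => (k x : ℝ)⁻¹)
      (fun x => by simp [(hk x).ne']) i.1 (jewelVec (k i.1) i.2)
    rw [← Finset.sum_mul, ← Finset.sum_mul, sum_jewelVec (hk i.1), zero_mul] at h1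
    exact (mul_eq_zero.1 h1).resolve_right
      (Finset.prod_ne_zero_iff.2 fun x _ => inv_ne_zero (Nat.cast_ne_zero.2 (hk x).ne'))
  obtain ⟨G, hG, hGE⟩ := exists_povm_of_diagonal_subset hd
    (fun (i : JewelIndex k) (ε : (x : Fin g) → Fin (k x)) => jewelVec (k i.1) i.2 (ε i.1)) hv _ (isHermitian_effectTuple hE) h
  refine (compatible_iff_exists_joint E).2 ⟨G, hG, fun x => ?_⟩
  refine congrFun (eq_of_sum_jewelVec_smul_eq ?_ fun j => ?_)
  · rw [(hE x).sum_eq_one, Finset.sum_comm, ← hG.sum_eq_one]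
    simp only [← Finset.sum_smul]
    simp
  · exact (hGE ⟨x, j⟩).trans (effectTuple_eq_of_joint
      (E := fun x a => ∑ ε, (if ε x = a then (1 : ℝ) else 0) • G ε) (fun _ _ => rfl) ⟨x, j⟩).symm

theorem mem_jewelInclusionSet_iff (hd : 0 < d) (hk : ∀ x, 0 < k x) {s : Fin g → ℝ}
    (hs : ∀ x, s x ∈ Set.Icc (0 : ℝ) 1) :
    s ∈ jewelInclusionSet k d ↔
      ∀ E ∈ povmTuples g k d, Compatible (mix s E (whiteNoise k d)) := by
  constructor
  · rintro ⟨-, h⟩ E hE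
    have h1 := h _ (isHermitian_effectTuple hE) (matrixJewel_one_subset_of_povm hk hE) d
    rw [smul_image_subset_iff, ← funext (effectTuple_mix hk s E)] at h1
    exact compatible_of_matrixJewel_subset hd hk (mix_whiteNoise_mem hk hs hE) h1
  · refine fun h => ⟨hs, fun B _ hB n => ?_⟩
    obtain ⟨E, hE, rfl⟩ := exists_povm_of_matrixJewel_one_subset hk hB
    rw [smul_image_subset_iff, ← funext (effectTuple_mix hk s E)]
    exact matrixJewel_subset_of_compatible (h E hE) n

end Jewel

end Steering

theorem mainTheorem9 (g d : ℕ) (k : Fin g → ℕ) (hk : ∀ x, 0 < k x)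
    (avg : Matrix (Fin d) (Fin d) ℂ) (havg : IsDensityMatrix avg) (hinv : IsUnit avg) :
    -- the correspondence between assemblages with the given average and tuples of POVMs
    (Set.MapsTo (toPOVM avg) (assemblages k avg) (povmTuples g k d) ∧
      Set.MapsTo (ofPOVM avg) (povmTuples g k d) (assemblages k avg) ∧
      Set.InvOn (ofPOVM avg) (toPOVM avg) (assemblages k avg) (povmTuples g k d)) ∧
    -- LHS models correspond to compatibility
    (∀ σ ∈ assemblages k avg, HasLHSModel σ ↔ Compatible (toPOVM avg σ)) ∧
    -- mixing with the trivial assemblage corresponds to mixing in white noise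
    (∀ s : Fin g → ℝ, (∀ x, s x ∈ Set.Icc (0 : ℝ) 1) →
      (∀ σ ∈ assemblages k avg,
        toPOVM avg (mix s σ (trivialAssemblage k avg)) = mix s (toPOVM avg σ) (whiteNoise k d)) ∧
      ∀ E ∈ povmTuples g k d,
        ofPOVM avg (mix s E (whiteNoise k d)) =
          mix s (ofPOVM avg E) (trivialAssemblage k avg)) ∧
    -- steering robustness
    {s : Fin g → ℝ | (∀ x, s x ∈ Set.Icc (0 : ℝ) 1) ∧
      (fun σ => mix s σ (trivialAssemblage k avg)) '' assemblages k avg ⊆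
        lhsAssemblages k avg} = jewelInclusionSet k d := by
  have hpos := havg.posSemidef
  -- The empty matrix has trace 0, not 1.
  have hd : 0 < d := by
    rcases Nat.eq_zero_or_pos d with rfl | hd
    · simpa [Matrix.trace] using havg.trace_eq_one
    · exact hd
  refine ⟨⟨fun σ hσ => toPOVM_mem hpos hinv hσ, fun E hE => ofPOVM_mem hpos hE,
      fun σ _ => ofPOVM_toPOVM hpos hinv σ, fun E _ => toPOVM_ofPOVM hpos hinv E⟩,
    fun σ hσ => hasLHSModel_iff_compatible havg hinv hσ,
    fun s _ => ⟨fun σ _ => toPOVM_mix hpos hinv s σ, fun E _ => ofPOVM_mix hpos s E⟩, ?_⟩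
  ext s
  constructor
  · rintro ⟨hs, h⟩
    exact (mem_jewelInclusionSet_iff hd hk hs).2
      ((mix_image_subset_lhsAssemblages_iff havg hinv hk hs).1 h)
  · intro h
    exact ⟨h.1, (mix_image_subset_lhsAssemblages_iff havg hinv hk h.1).2
      ((mem_jewelInclusionSet_iff hd hk h.1).1 h)⟩
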